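/- Let $G$ be a finite group, $R$ an associative ring with unity, $R^*$ its group of units, and $\rho\colon G\to R^*$ a group homomorphism (for example, a linear representation $G\to\mathbf{GL}(V)$, with $R=\mathrm{End}(V)$). Let $m\ge 1$ and $k\ge 0$ be integers, let $u_1,\dots,u_k\in F(x_1,\dots,x_m)$ be elements of the free group of rank $m$, and let $l_1,\dots,l_k\in\mathbb Z$. For an integer $n$, let $\mathrm{GCD}(G,n)$ denote the least common multiple of the orders of those subgroups of $G$ whose order divides $n$ (so $\mathrm{GCD}(G,0)=|G|$). Let $N$ be the number of tuples $(x_1,\dots,x_m)\in G^m$ satisfying $$\sum_{i=1}^k \bigl(\rho(u_i(x_1,\dots,x_m))\bigr)^{l_i}=1\quad\text{in } R.$$ Then: 1. $N$ is divisible by $\mathrm{GCD}(G,\gcd(l_1,\dots,l_k))$; 2. if $k\le m$, then $N$ is divisible by $\mathrm{GCD}(G,\mathrm{lcm}(l_1,\dots,l_k))$; 3. if $k<m$, then $N$ is divisible by $|G|$. Here $\gcd$ and $\mathrm{lcm}$ of an empty family are $0$ and $1$ respectively, $\gcd(0,\dots,0)=0$, and an $\mathrm{lcm}$ of a family containing $0$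 is $0$. -/

import Mathlib

/-- `GCD(G, n)` for a finite group `G` and an integer `n`: the least common multiple of the orders
of those subgroups of `G` whose order divides `n`. -/
noncomputable def groupGCD (G : Type*) [Group G] [Finite G] (n : ℤ) : ℕ :=
  (Set.toFinite {H : Subgroup G | (Nat.card H : ℤ) ∣ n}).toFinset.lcm fun H => Nat.card H

/-- The tuples `x = (x₁, …, xₘ) ∈ Gᵐ` with `∑ᵢ ρ(uᵢ(x)) ^ lᵢ = 1` in `R`. The powers are taken in the
group of units, the sum in the ring. -/
def solutionSet {G R : Type*} [Group G] [Ring R] (ρ : G →* Rˣ) {k m : ℕ}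
    (u : Fin k → FreeGroup (Fin m)) (l : Fin k → ℤ) : Set (Fin m → G) :=
  {x | ∑ i : Fin k, ((ρ (FreeGroup.lift x (u i)) ^ l i : Rˣ) : R) = 1}

/-! Tuples are homomorphisms `φ : F →* G` from the free group, and divisibility is checked on prime
powers `p ^ a ∣ Nat.card G`. Apart from `p ^ a = 1`, each claim provides a set `I` of fewer than `m`
indices outside which `p ^ a ∣ l i`. By linear algebra some surjective degree map `F → ℤ` kills `u
i` for `i ∈ I`. Then every `u i ^ l i` lies in the subgroup `D` of degrees divisible by `p ^ a`, so
the equation sees only `φ` on `D`.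

Take `H ≤ G` of order `p ^ a` and `t` of degree 1. Solutions are stable under conjugation by `H` and
under twists, which fix `φ` on `D` and replace `φ t` by `φ t * k`, with `k` in the twist core `K ≤
H`. Such twists exist (`exists_isTwist`) because `(φ t * k) ^ p ^ a = φ t ^ p ^ a`. A class under
both operations has `|H/K| * |K| = |H|` elements. -/

/-- If `g` normalizes a finite `p`-group `K` of order at most `p ^ a` and `g ^ p ^ a` centralizes `K`,
then `g ^ p ^ a` is the `p ^ a`-th power of every element of the coset `g K`. -/
theorem mul_pow_prime_pow_of_normalizes {G : Type*} [Group G] {p a b : ℕ} (hp : p.Prime)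
    (K : Subgroup G) (hK : Nat.card K = p ^ b) (hab : b ≤ a) {g : G}
    (hg : ∀ k ∈ K, g⁻¹ * k * g ∈ K) (hc : ∀ k ∈ K, g ^ p ^ a * k = k * g ^ p ^ a)
    {k : G} (hk : k ∈ K) : (g * k) ^ p ^ a = g ^ p ^ a := by
  have hfin : Finite K := Nat.finite_of_card_ne_zero (by rw [hK]; exact (pow_pos hp.pos b).ne')
  have := Fintype.ofFinite K
  -- The orbit of 1 under `f` records how far `(g * k) ^ n` is from `g ^ n`. Its period divides a
  -- power of `p` and is at most `|K|`, hence divides `p ^ a`.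
  let f : K → K := fun y => ⟨g⁻¹ * y * g * k, K.mul_mem (hg y y.2) hk⟩
  have hf : ∀ n : ℕ, ((f^[n] 1 : K) : G) = (g ^ n)⁻¹ * (g * k) ^ n := by
    intro n
    induction n with
    | zero => simp
    | succ n ih =>
      rw [Function.iterate_succ_apply']
      change g⁻¹ * (f^[n] 1 : K) * g * k = _
      rw [ih, pow_succ, pow_succ]
      group
  have hper : Function.IsPeriodicPt f (p ^ a * p ^ b) 1 := by
    have hcK : (g ^ p ^ a)⁻¹ * (g * k) ^ p ^ a ∈ K := hf (p ^ a) ▸ (f^[p ^ a] 1).2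
    have hcomm : Commute (g ^ p ^ a) ((g ^ p ^ a)⁻¹ * (g * k) ^ p ^ a) := hc _ hcK
    have h1 : ((g ^ p ^ a)⁻¹ * (g * k) ^ p ^ a) ^ p ^ b = 1 := by
      have h := pow_card_eq_one' (x := (⟨_, hcK⟩ : K))
      rw [hK] at h
      exact congrArg Subtype.val h
    apply Subtype.ext
    rw [hf, pow_mul, pow_mul]
    have h2 := hcomm.mul_pow (p ^ b)
    rw [mul_inv_cancel_left, h1, mul_one] at h2
    rw [h2, inv_mul_cancel]
    rfl
  rw [← pow_add] at hper
  obtain ⟨c, -, hc'⟩ := (Nat.dvd_prime_pow hp).1 hper.minimalPeriod_dvd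
  have hle : p ^ c ≤ p ^ b := by
    rw [← hc', ← hK, Nat.card_eq_fintype_card]
    exact Function.minimalPeriod_le_card
  have hdvd : Function.minimalPeriod f 1 ∣ p ^ a := by
    rw [hc']
    exact pow_dvd_pow p (((Nat.pow_le_pow_iff_right hp.one_lt).1 hle).trans hab)
  have h := hf (p ^ a)
  rw [show f^[p ^ a] 1 = 1 from Function.isPeriodicPt_iff_minimalPeriod_dvd.2 hdvd] at h
  exact (inv_mul_eq_one.1 h.symm).symm

/-! ### Twists of homomorphisms and the size of their classes -/

section Twist

variable {F G : Type*} [Group F] [Group G]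

/-- The elements of `G` that commute with `φ D` and whose conjugates by `φ F` all lie in `H`. -/
def twistCore (H : Subgroup G) (D : Subgroup F) (φ : F →* G) : Subgroup G where
  carrier := {h | (∀ f, (φ f)⁻¹ * h * φ f ∈ H) ∧ ∀ d ∈ D, φ d * h = h * φ d}
  one_mem' := by simp [H.one_mem]
  mul_mem' := by
    rintro x y ⟨hx, hx'⟩ ⟨hy, hy'⟩
    refine ⟨fun f => ?_, fun d hd => ?_⟩
    · have := H.mul_mem (hx f) (hy f)
      rwa [show (φ f)⁻¹ * x * φ f * ((φ f)⁻¹ * y * φ f) = (φ f)⁻¹ * (x * y) * φ f by group] at this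
    · exact Commute.mul_right (hx' d hd) (hy' d hd)
  inv_mem' := by
    rintro x ⟨hx, hx'⟩
    refine ⟨fun f => ?_, fun d hd => ?_⟩
    · have := H.inv_mem (hx f)
      rwa [show ((φ f)⁻¹ * x * φ f)⁻¹ = (φ f)⁻¹ * x⁻¹ * φ f by group] at this
    · exact Commute.inv_right (hx' d hd)

/-- `ψ` agrees with `φ` on `D` and differs from it by elements of the twist core of `φ`. -/
def IsTwist (H : Subgroup G) (D : Subgroup F) (φ ψ : F →* G) : Prop :=
  (∀ d ∈ D, ψ d = φ d) ∧ ∀ f, (φ f)⁻¹ * ψ f ∈ twistCore H D φ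

/-- The homomorphism `φ` followed by conjugation by `g`. -/
def conjHom (g : G) (φ : F →* G) : F →* G := (MulAut.conj g).toMonoidHom.comp φ

@[simp] theorem conjHom_apply (g : G) (φ : F →* G) (f : F) : conjHom g φ f = g * φ f * g⁻¹ := rfl

theorem conjHom_mul (g h : G) (φ : F →* G) : conjHom (g * h) φ = conjHom g (conjHom h φ) := by
  ext f; simp [mul_assoc]

theorem conjHom_one (φ : F →* G) : conjHom 1 φ = φ := by
  ext f; simp

variable {H : Subgroup G} {D : Subgroup F} {φ ψ χ : F →* G}

theorem twistCore_le : twistCore H D φ ≤ H := fun h hh => by simpa using hh.1 1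

theorem conj_mem_twistCore [D.Normal] {h : G} (hh : h ∈ twistCore H D φ) (f : F) :
    (φ f)⁻¹ * h * φ f ∈ twistCore H D φ := by
  refine ⟨fun f' => ?_, fun d hd => ?_⟩
  · have := hh.1 (f * f')
    rw [map_mul] at this
    rwa [show (φ f')⁻¹ * ((φ f)⁻¹ * h * φ f) * φ f' = (φ f * φ f')⁻¹ * h * (φ f * φ f') by group]
  · have := hh.2 (f * d * f⁻¹) (Subgroup.Normal.conj_mem ‹_› d hd f)
    simp only [map_mul, map_inv] at this
    calc φ d * ((φ f)⁻¹ * h * φ f) = (φ f)⁻¹ * (φ f * φ d * (φ f)⁻¹ * h) * φ f := by group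
      _ = _ := by rw [this]; group

theorem IsTwist.refl (φ : F →* G) : IsTwist H D φ φ := ⟨fun _ _ => rfl, fun f => by simp⟩

theorem IsTwist.twistCore_le [D.Normal] (h : IsTwist H D φ ψ) :
    twistCore H D φ ≤ twistCore H D ψ := by
  intro x hx
  refine ⟨fun f => _root_.twistCore_le (D := D) (φ := φ) ?_, fun d hd => ?_⟩
  · have := mul_mem (mul_mem (inv_mem (h.2 f)) (conj_mem_twistCore hx f)) (h.2 f)
    convert this using 1
    group
  · rw [h.1 d hd]
    exact hx.2 d hd

theorem IsTwist.symm [D.Normal] (h : IsTwist H D φ ψ) : IsTwist H D ψ φ :=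
  ⟨fun d hd => (h.1 d hd).symm, fun f => h.twistCore_le (by simpa using inv_mem (h.2 f))⟩

theorem IsTwist.trans [D.Normal] (h : IsTwist H D φ ψ) (h' : IsTwist H D ψ χ) :
    IsTwist H D φ χ :=
  ⟨fun d hd => (h'.1 d hd).trans (h.1 d hd), fun f => by
    have := mul_mem (h.2 f) (h.symm.twistCore_le (h'.2 f))
    convert this using 1
    group⟩

theorem conj_mem_twistCore_conjHom {g h : G} (hg : g ∈ H) (hh : h ∈ twistCore H D φ) :
    g * h * g⁻¹ ∈ twistCore H D (conjHom g φ) := by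
  refine ⟨fun f => ?_, fun d hd => ?_⟩
  · have := mul_mem (mul_mem hg (hh.1 f)) (inv_mem hg)
    convert this using 1
    simp only [conjHom_apply]
    group
  · simp only [conjHom_apply]
    calc g * φ d * g⁻¹ * (g * h * g⁻¹) = g * (φ d * h) * g⁻¹ := by group
      _ = _ := by rw [hh.2 d hd]; group

theorem IsTwist.conjHom {g : G} (hg : g ∈ H) (h : IsTwist H D φ ψ) :
    IsTwist H D (conjHom g φ) (conjHom g ψ) := by
  refine ⟨fun d hd => by simp [h.1 d hd], fun f => ?_⟩
  have := conj_mem_twistCore_conjHom hg (h.2 f)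
  convert this using 1
  simp only [conjHom_apply]
  group

theorem isTwist_conjHom_iff [D.Normal] {g : G} (hg : g ∈ H) :
    IsTwist H D φ (conjHom g φ) ↔ g ∈ twistCore H D φ := by
  constructor
  · intro h
    refine ⟨fun f => ?_, fun d hd => ?_⟩
    · have := mul_mem (twistCore_le (h.2 f)) hg
      convert this using 1
      simp only [conjHom_apply]
      group
    · have := h.1 d hd
      rw [conjHom_apply, mul_inv_eq_iff_eq_mul] at this
      exact this.symm
  · intro h
    refine ⟨fun d hd => ?_, fun f => ?_⟩
    · rw [conjHom_apply, mul_inv_eq_iff_eq_mul]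
      exact (h.2 d hd).symm
    · have := mul_mem (conj_mem_twistCore h f) (inv_mem h)
      convert this using 1
      simp only [conjHom_apply]
      group

/-- Two homomorphisms are related when a twist of an `H`-conjugate of one is the other. -/
def twistConjSetoid (H : Subgroup G) (D : Subgroup F) [D.Normal] (Φ : Set (F →* G)) : Setoid Φ where
  r φ ψ := ∃ g ∈ H, IsTwist H D (conjHom g φ) (ψ : F →* G)
  iseqv :=
    { refl := fun φ => ⟨1, H.one_mem, by rw [conjHom_one]; exact IsTwist.refl _⟩
      symm := by
        rintro φ ψ ⟨g, hg, h⟩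
        refine ⟨g⁻¹, inv_mem hg, ?_⟩
        have := (h.conjHom (inv_mem hg)).symm
        rwa [← conjHom_mul, inv_mul_cancel, conjHom_one] at this
      trans := by
        rintro φ ψ χ ⟨g, hg, h⟩ ⟨g', hg', h'⟩
        refine ⟨g' * g, mul_mem hg' hg, ?_⟩
        rw [conjHom_mul]
        exact (h.conjHom hg').trans h' }

/-- A finite set of homomorphisms `F →* G` that is closed under conjugation by `H` and under twists
has size divisible by the order of `H`. -/
theorem card_dvd_card_of_conjHom_mem_of_isTwist_mem [D.Normal] [Finite H] (Φ : Set (F →* G))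
    [Finite Φ] (t : F)
    (hext : ∀ φ ψ : F →* G, (∀ d ∈ D, φ d = ψ d) → φ t = ψ t → φ = ψ)
    (hex : ∀ φ : F →* G, ∀ k ∈ twistCore H D φ, ∃ ψ, IsTwist H D φ ψ ∧ ψ t = φ t * k)
    (hconj : ∀ φ ∈ Φ, ∀ g ∈ H, conjHom g φ ∈ Φ)
    (htwist : ∀ φ ∈ Φ, ∀ ψ, IsTwist H D φ ψ → ψ ∈ Φ) :
    Nat.card H ∣ Nat.card Φ := by
  let s := twistConjSetoid H D Φ
  have hclass : ∀ c : Quotient s, Nat.card {ψ : Φ // Quotient.mk s ψ = c} = Nat.card H := by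
    intro c
    induction c using Quotient.inductionOn with
    | h φ =>
    obtain ⟨φ, hφ⟩ := φ
    set K := twistCore H D φ
    choose! tw htw htwt using hex φ
    -- Conjugators matter only modulo `K`, since conjugating `φ` by an element of `H` gives a twist
    -- exactly when that element lies in `K`.
    let T : (H ⧸ K.subgroupOf H) × K.subgroupOf H →
        {ψ : Φ // Quotient.mk s ψ = Quotient.mk s ⟨φ, hφ⟩} := fun x =>
      ⟨⟨conjHom (x.1.out : G) (tw x.2), hconj _ (htwist φ hφ _ (htw _ x.2.2)) _ x.1.out.2⟩,
        Eq.symm (Quotient.sound (s := s) (show ∃ g ∈ H, IsTwist H D (conjHom g φ) _ from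
          ⟨x.1.out, x.1.out.2, (htw _ x.2.2).conjHom x.1.out.2⟩))⟩
    have hT : Function.Bijective T := by
      constructor
      · rintro ⟨c, k⟩ ⟨c', k'⟩ h
        have h1 : conjHom (c.out : G) (tw k) = conjHom (c'.out : G) (tw k') :=
          congrArg (fun z => (z.1.1 : F →* G)) h
        have h2 : tw k = conjHom ((c.out : G)⁻¹ * c'.out) (tw k') := by
          rw [conjHom_mul, ← h1, ← conjHom_mul, inv_mul_cancel, conjHom_one]
        have hm : (c.out : G)⁻¹ * c'.out ∈ H := mul_mem (inv_mem c.out.2) c'.out.2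
        have h3 : IsTwist H D φ (conjHom ((c.out : G)⁻¹ * c'.out) φ) := by
          refine (htw (k : H) k.2).trans ?_
          rw [h2]
          exact ((htw _ k'.2).symm).conjHom hm
        have h4 := (isTwist_conjHom_iff hm).1 h3
        have h5 : c = c' := by
          rw [← c.out_eq, ← c'.out_eq]
          exact QuotientGroup.eq.2 h4
        subst h5
        rw [inv_mul_cancel, conjHom_one] at h2
        have h6 := htwt (k : H) k.2
        rw [h2, htwt (k' : H) k'.2] at h6
        rw [Subtype.ext (Subtype.ext (mul_left_cancel h6))]
      · rintro ⟨⟨ψ, hψ⟩, h⟩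
        obtain ⟨g, hg, h⟩ := Quotient.exact h.symm
        change IsTwist H D (conjHom g φ) ψ at h
        obtain ⟨k₀, hk₀⟩ := QuotientGroup.mk_out_eq_mul (K.subgroupOf H) ⟨g, hg⟩
        set c : H ⧸ K.subgroupOf H := QuotientGroup.mk ⟨g, hg⟩
        have hc : (c.out : G) = g * (k₀ : H) := congrArg Subtype.val hk₀
        have h1 : IsTwist H D φ (conjHom (c.out : G)⁻¹ ψ) := by
          have h2 := h.conjHom (inv_mem hg)
          rw [← conjHom_mul, inv_mul_cancel, conjHom_one] at h2
          have hk₀' : ((k₀ : H) : G)⁻¹ ∈ H := inv_mem (k₀ : H).2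
          have h3 := h2.conjHom hk₀'
          rw [← conjHom_mul, ← mul_inv_rev, ← hc] at h3
          exact ((isTwist_conjHom_iff hk₀').2 (inv_mem k₀.2)).trans h3
        have hkm := h1.2 t
        refine ⟨(c, ⟨⟨_, twistCore_le hkm⟩, hkm⟩), Subtype.ext (Subtype.ext ?_)⟩
        change conjHom (c.out : G) (tw _) = ψ
        have h4 : tw ((φ t)⁻¹ * conjHom (c.out : G)⁻¹ ψ t) = conjHom (c.out : G)⁻¹ ψ := by
          refine hext _ _ (fun d hd => ?_) ?_
          · rw [(htw _ hkm).1 d hd, h1.1 d hd]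
          · rw [htwt _ hkm, mul_inv_cancel_left]
        rw [h4, ← conjHom_mul, mul_inv_cancel, conjHom_one]
    rw [← Nat.card_eq_of_bijective T hT, Nat.card_prod,
      ← Subgroup.card_eq_card_quotient_mul_card_subgroup]
  have := Fintype.ofFinite (Quotient s)
  rw [← Nat.card_congr (Equiv.sigmaFiberEquiv (Quotient.mk s)), Nat.card_sigma]
  exact Finset.dvd_sum fun c _ => (hclass c).symm.dvd

end Twist

/-! ### Existence of twists from a degree map -/

section Degree

variable {F G : Type*} [Group F] [Group G]

/-- The elements of `F` whose degree is divisible by `q`. -/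
def degreeDvd (deg : F →* Multiplicative ℤ) (q : ℕ) : Subgroup F :=
  (Subgroup.zpowers (Multiplicative.ofAdd (q : ℤ))).comap deg

instance (deg : F →* Multiplicative ℤ) (q : ℕ) : (degreeDvd deg q).Normal :=
  Subgroup.Normal.comap inferInstance _

theorem mem_degreeDvd {deg : F →* Multiplicative ℤ} {q : ℕ} {f : F} :
    f ∈ degreeDvd deg q ↔ (q : ℤ) ∣ (deg f).toAdd := by
  rw [degreeDvd, Subgroup.mem_comap, Subgroup.mem_zpowers_iff]
  constructor
  · rintro ⟨n, hn⟩
    rw [← hn]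
    simp
  · rintro ⟨n, hn⟩
    refine ⟨n, Multiplicative.toAdd.injective ?_⟩
    rw [hn]
    simp [mul_comm]

variable {deg : F →* Multiplicative ℤ} {t : F}

theorem mul_zpow_neg_degree_mem (ht : deg t = Multiplicative.ofAdd 1) (q : ℕ) (f : F) :
    f * t ^ (-(deg f).toAdd) ∈ degreeDvd deg q := by
  rw [mem_degreeDvd]
  simp [ht]

theorem hom_ext_of_degree (ht : deg t = Multiplicative.ofAdd 1) (q : ℕ) (φ ψ : F →* G)
    (h : ∀ d ∈ degreeDvd deg q, φ d = ψ d) (h' : φ t = ψ t) : φ = ψ := by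
  ext f
  have := h _ (mul_zpow_neg_degree_mem ht q f)
  rw [map_mul, map_mul, map_zpow, map_zpow, h'] at this
  exact mul_right_cancel this

/-- The formula is `ψ f = φ f * A (deg f)`, where the cocycle `A` compares powers of `φ t * k` and
`φ t`. It is trivial on `D` because `A` vanishes at multiples of `p ^ a`. -/
theorem exists_isTwist (ht : deg t = Multiplicative.ofAdd 1) {p a : ℕ} (hp : p.Prime)
    (H : Subgroup G) (hH : Nat.card H = p ^ a) (φ : F →* G) {k : G}
    (hk : k ∈ twistCore H (degreeDvd deg (p ^ a)) φ) :
    ∃ ψ, IsTwist H (degreeDvd deg (p ^ a)) φ ψ ∧ ψ t = φ t * k := by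
  set D := degreeDvd deg (p ^ a) with hD
  set K := twistCore H D φ
  let A : ℤ → G := fun d => (φ t ^ d)⁻¹ * (φ t * k) ^ d
  have hAK : ∀ d, A d ∈ K := by
    intro d
    induction d using Int.induction_on with
    | zero => simp [A, K.one_mem]
    | succ d ih =>
      have := mul_mem (conj_mem_twistCore ih t) hk
      convert this using 1
      simp only [A, zpow_add, zpow_one]
      group
    | pred d ih =>
      have := conj_mem_twistCore (mul_mem ih (inv_mem hk)) t⁻¹
      convert this using 1
      simp only [A, sub_eq_add_neg, zpow_add, zpow_neg, zpow_one, map_inv, inv_inv]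
      group
  have hpow : (φ t * k) ^ p ^ a = φ t ^ p ^ a := by
    have hfin : Finite H := Nat.finite_of_card_ne_zero (by rw [hH]; exact (pow_pos hp.pos a).ne')
    obtain ⟨b, hb, hb'⟩ := (Nat.dvd_prime_pow hp).1
      (hH ▸ Subgroup.card_dvd_of_le (twistCore_le : K ≤ H))
    refine mul_pow_prime_pow_of_normalizes hp K hb' hb (fun k hk => conj_mem_twistCore hk t)
      (fun k hk => ?_) hk
    rw [← map_pow]
    exact hk.2 _ (by rw [hD, mem_degreeDvd, map_pow, ht]; simp)
  have hA1 : ∀ n : ℤ, A ((p ^ a : ℕ) * n) = 1 := by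
    intro n
    simp only [A]
    rw [zpow_mul, zpow_mul, zpow_natCast, zpow_natCast, hpow, inv_mul_cancel]
  -- Since `f * t ^ (-deg f)` lies in `D`, its image centralizes `K`, so `φ f` acts on `K` as `φ t ^
  -- deg f` does.
  have hcomm : ∀ f d, A d * φ f = φ f * ((φ t ^ (deg f).toAdd)⁻¹ * A d * φ t ^ (deg f).toAdd) := by
    intro f d
    have := (hAK d).2 _ (mul_zpow_neg_degree_mem ht (p ^ a) f)
    rw [map_mul, map_zpow, zpow_neg] at this
    calc A d * φ f = A d * (φ f * (φ t ^ (deg f).toAdd)⁻¹) * φ t ^ (deg f).toAdd := by group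
      _ = _ := by rw [← this]; group
  refine ⟨MonoidHom.mk' (fun f => φ f * A (deg f).toAdd) fun f f' => ?_,
    ⟨fun d hd => ?_, fun f => ?_⟩, ?_⟩
  · have : A (deg (f * f')).toAdd = (φ t ^ (deg f').toAdd)⁻¹ * A (deg f).toAdd *
        φ t ^ (deg f').toAdd * A (deg f').toAdd := by
      simp only [A, map_mul, toAdd_mul, zpow_add]
      group
    rw [this, map_mul]
    calc _ = φ f * (φ f' * ((φ t ^ (deg f').toAdd)⁻¹ * A (deg f).toAdd * φ t ^ (deg f').toAdd)) *
          A (deg f').toAdd := by group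
      _ = _ := by rw [← hcomm]; group
  · obtain ⟨n, hn⟩ := mem_degreeDvd.1 hd
    rw [MonoidHom.mk'_apply, hn, hA1, mul_one]
  · simpa using hAK _
  · simp [ht, A]

end Degree

/-! ### Choice of the degree map and the prime power case -/

/-- Fewer than `m` words in a free group of rank `m` lie in the kernel of some degree map onto `ℤ`. -/
theorem exists_surjective_degree {k m : ℕ} (u : Fin k → FreeGroup (Fin m)) (I : Finset (Fin k))
    (hI : I.card < m) : ∃ (deg : FreeGroup (Fin m) →* Multiplicative ℤ) (t : FreeGroup (Fin m)),
      deg t = Multiplicative.ofAdd 1 ∧ ∀ i ∈ I, deg (u i) = 1 := by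
  let E : FreeGroup (Fin m) → (Fin m → ℤ) →+ ℤ := fun f => AddMonoidHom.mk'
    (fun v => (FreeGroup.lift (fun j => Multiplicative.ofAdd (v j)) f).toAdd) fun v w => by
      rw [← toAdd_mul, ← MonoidHom.mul_apply]
      congr 2
      ext j
      simp
  let L : (Fin m → ℤ) →ₗ[ℤ] (I → ℤ) := LinearMap.pi fun i => (E (u i)).toIntLinearMap
  have hL : ¬ Function.Injective L := fun h => by
    have := card_le_of_injective ℤ L h
    simp at this
    omega
  obtain ⟨v, hv, hv0⟩ : ∃ v, L v = 0 ∧ v ≠ 0 := by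
    rw [injective_iff_map_eq_zero] at hL
    push Not at hL
    exact hL
  -- Dividing `v` by the gcd of its entries makes the degree map surjective.
  obtain ⟨w, hw, hw1⟩ := Finset.univ.extract_gcd v
    (Finset.univ_nonempty_iff.2 ⟨⟨0, by omega⟩⟩)
  set g := Finset.univ.gcd v
  have hvw : v = g • w := funext fun j => by simpa using hw j (Finset.mem_univ j)
  have hg : g ≠ 0 := by
    rintro hg
    exact hv0 (by rw [hvw, hg, zero_smul])
  have hLw : L w = 0 := by
    rw [hvw, map_smul] at hv
    exact (smul_eq_zero.1 hv).resolve_left hg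
  obtain ⟨c, hc⟩ := Finset.gcd_eq_sum_mul Finset.univ w
  let deg := FreeGroup.lift (fun j => Multiplicative.ofAdd (w j))
  have hmem : Multiplicative.ofAdd 1 ∈ deg.range := by
    rw [← hw1, hc, ofAdd_sum]
    refine Subgroup.prod_mem _ fun j _ => ⟨FreeGroup.of j ^ c j, ?_⟩
    apply Multiplicative.toAdd.injective
    simp [deg, mul_comm]
  obtain ⟨t, ht⟩ := hmem
  exact ⟨deg, t, ht, fun i hi => Multiplicative.toAdd.injective (congrFun hLw ⟨i, hi⟩)⟩

theorem prime_pow_dvd_card_solutionSet {G R : Type*} [Group G] [Finite G] [Ring R] (ρ : G →* Rˣ)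
    {k m : ℕ} (u : Fin k → FreeGroup (Fin m)) (l : Fin k → ℤ) {p a : ℕ} (hp : p.Prime)
    (hG : p ^ a ∣ Nat.card G) (I : Finset (Fin k)) (hI : I.card < m)
    (hl : ∀ i ∉ I, ((p ^ a : ℕ) : ℤ) ∣ l i) : p ^ a ∣ Nat.card (solutionSet ρ u l) := by
  have := Fact.mk hp
  obtain ⟨H, hH⟩ := Sylow.exists_subgroup_card_pow_prime p hG
  obtain ⟨deg, t, ht, hdeg⟩ := exists_surjective_degree u I hI
  let Φ : Set (FreeGroup (Fin m) →* G) :=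
    {φ | ∑ i : Fin k, ((ρ (φ (u i)) ^ l i : Rˣ) : R) = 1}
  let e : solutionSet ρ u l ≃ Φ := FreeGroup.lift.subtypeEquiv fun x => Iff.rfl
  have : Finite Φ := Finite.of_equiv _ e
  rw [Nat.card_congr e, ← hH]
  refine card_dvd_card_of_conjHom_mem_of_isTwist_mem (D := degreeDvd deg (p ^ a)) Φ t
    (hom_ext_of_degree ht _) (fun φ k hk => exists_isTwist ht hp H hH φ hk) ?_ ?_
  · intro φ hφ g _
    have h : ∀ i, ((ρ (conjHom g φ (u i)) ^ l i : Rˣ) : R) =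
        (ρ g : Rˣ) * ((ρ (φ (u i)) ^ l i : Rˣ) : R) * ((ρ g)⁻¹ : Rˣ) := by
      intro i
      rw [conjHom_apply, map_mul, map_mul, map_inv, conj_zpow]
      simp
    change ∑ i, ((ρ (conjHom g φ (u i)) ^ l i : Rˣ) : R) = 1
    simp_rw [h]
    rw [← Finset.sum_mul, ← Finset.mul_sum, show ∑ i, ((ρ (φ (u i)) ^ l i : Rˣ) : R) = 1 from hφ]
    simp
  · intro φ hφ ψ h
    change ∑ i, ((ρ (ψ (u i)) ^ l i : Rˣ) : R) = 1
    rw [← show ∑ i, ((ρ (φ (u i)) ^ l i : Rˣ) : R) = 1 from hφ]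
    refine Finset.sum_congr rfl fun i _ => ?_
    rw [← map_zpow, ← map_zpow, ← map_zpow, ← map_zpow, h.1]
    rw [mem_degreeDvd, map_zpow]
    by_cases hi : i ∈ I
    · simp [hdeg i hi]
    · simpa using (hl i hi).mul_right _

theorem Nat.Prime.pow_dvd_or_pow_dvd_of_pow_dvd_lcm {p a x y : ℕ} (hp : p.Prime)
    (h : p ^ a ∣ x.lcm y) : p ^ a ∣ x ∨ p ^ a ∣ y := by
  rcases eq_or_ne x 0 with rfl | hx
  · exact Or.inl (dvd_zero _)
  rcases eq_or_ne y 0 with rfl | hy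
  · exact Or.inr (dvd_zero _)
  rw [hp.pow_dvd_iff_le_factorization (Nat.lcm_ne_zero hx hy), Nat.factorization_lcm hx hy,
    Finsupp.sup_apply, le_sup_iff] at h
  rwa [hp.pow_dvd_iff_le_factorization hx, hp.pow_dvd_iff_le_factorization hy]

theorem Int.exists_prime_pow_dvd_of_dvd_lcm {ι : Type*} {p a : ℕ} (hp : p.Prime) (s : Finset ι)
    (l : ι → ℤ) (h : ((p ^ a : ℕ) : ℤ) ∣ s.lcm l) :
    -- The first alternative covers the empty family, whose lcm is 1.
    p ^ a = 1 ∨ ∃ i ∈ s, ((p ^ a : ℕ) : ℤ) ∣ l i := by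
  classical
  induction s using Finset.induction_on with
  | empty =>
    left
    rw [Finset.lcm_empty] at h
    exact Nat.dvd_one.1 (by exact_mod_cast h)
  | insert i s hi ih =>
    rw [Finset.lcm_insert] at h
    have : ((p ^ a : ℕ) : ℤ) ∣ l i ∨ ((p ^ a : ℕ) : ℤ) ∣ s.lcm l := by
      rw [← Int.coe_lcm, Int.natCast_dvd_natCast] at h
      rw [Int.natCast_dvd, Int.natCast_dvd]
      exact hp.pow_dvd_or_pow_dvd_of_pow_dvd_lcm h
    rcases this with h | h
    · exact Or.inr ⟨i, Finset.mem_insert_self _ _, h⟩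
    · exact (ih h).imp_right fun ⟨j, hj, h⟩ => ⟨j, Finset.mem_insert_of_mem hj, h⟩

theorem mainTheorem6 {G R : Type*} [Group G] [Finite G] [Ring R] (ρ : G →* Rˣ)
    (k m : ℕ) (hm : 1 ≤ m) (u : Fin k → FreeGroup (Fin m)) (l : Fin k → ℤ) :
    groupGCD G (Finset.univ.gcd l) ∣ Nat.card (solutionSet ρ u l) ∧
    (k ≤ m → groupGCD G (Finset.univ.lcm l) ∣ Nat.card (solutionSet ρ u l)) ∧
    (k < m → Nat.card G ∣ Nat.card (solutionSet ρ u l)) := by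
  have hred : ∀ n : ℤ, (∀ p a : ℕ, p.Prime → p ^ a ∣ Nat.card G → ((p ^ a : ℕ) : ℤ) ∣ n →
      p ^ a ∣ Nat.card (solutionSet ρ u l)) →
      groupGCD G n ∣ Nat.card (solutionSet ρ u l) := by
    intro n h
    refine Finset.lcm_dvd fun H hH => (Nat.dvd_iff_prime_pow_dvd_dvd _ _).2 fun p a hp hpa => ?_
    rw [Set.Finite.mem_toFinset, Set.mem_ofPred_eq] at hH
    exact h p a hp (hpa.trans H.card_subgroup_dvd_card) ((Int.natCast_dvd_natCast.2 hpa).trans hH)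
  refine ⟨hred _ fun p a hp hG hn => ?_, fun hkm => hred _ fun p a hp hG hn => ?_, fun hkm =>
    (Nat.dvd_iff_prime_pow_dvd_dvd _ _).2 fun p a hp hG => ?_⟩
  · exact prime_pow_dvd_card_solutionSet ρ u l hp hG ∅ (by rw [Finset.card_empty]; exact hm)
      fun i _ => hn.trans (Finset.gcd_dvd (Finset.mem_univ i))
  · rcases Int.exists_prime_pow_dvd_of_dvd_lcm hp _ l hn with h | ⟨j, -, hj⟩
    · simp [h]
    -- One exponent `l j` absorbs `p ^ a`, leaving `k - 1 < m` words for the degree map to kill.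
    · refine prime_pow_dvd_card_solutionSet ρ u l hp hG (Finset.univ.erase j) ?_ fun i hi => ?_
      · rw [Finset.card_erase_of_mem (Finset.mem_univ j), Finset.card_fin]
        have := j.pos
        omega
      · obtain rfl : i = j := by simpa using hi
        exact hj
  · exact prime_pow_dvd_card_solutionSet ρ u l hp hG Finset.univ (by simpa using hkm) (by simp)
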